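/- Let $n\ge 2$ and let $0<k_1\le k_2\le\dots\le k_n$ be real numbers. Consider the weighted star graph on the nodes $0,1,\dots,n$, in which the centre $0$ is linked to each leaf $i\in\{1,\dots,n\}$ with weight $k_i$ and there are no other links; thus $k_i$ is the degree of leaf $i$. Let $Q$ be its Laplacian matrix (weighted degrees on the diagonal, minus the link weights off the diagonal), $Q^\dagger$ the Moore–Penrose pseudoinverse of $Q$, and $\omega_{ij}=(e_i-e_j)^TQ^\dagger(e_i-e_j)$ the effective resistances, with matrix $\Omega=(\omega_{ij})$. For a probability vector $\mathbf p$ on the nodes put $\operatorname{var}_\omega(\mathbf p)=\tfrac12\mathbf p^T\Omega\mathbf p$. For $1\le\ell\le n$ put $S_\ell=\sum_{i=1}^{\ell}k_i$ and $T_\ell=(\ell-2)^{-1}S_\ell$, with $T_2=+\infty$. Below, an inequality involving $k_{n+1}$ is regarded as satisfied. There is a unique probability vector $\mathbf p^\star$ maximizing $\operatorname{var}_\omega$ over all probability vectors on the nodes. Let $\mathcal V^\star=\{i:p^\star_i>0\}$ be its support (the maximum variance support). 1. There is a unique $\ell\in\{1,\dots,n\}$ with $$k_\ell<T_\ell\le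 k_{\ell+1},$$ and for this $\ell$ the maximum variance support consists of the $\ell$ leaves of smallest degree, $\mathcal V^\star=\{1,\dots,\ell\}$, and $$p^\star_i=\frac12-\frac{(\ell-2)k_i}{2S_\ell}\quad(1\le i\le\ell),\qquad p^\star_i=0\ \text{ at all other nodes}.$$ 2. There is also a unique $\ell\in\{1,\dots,n\}$ with $$k_\ell\le T_\ell<k_{\ell+1}.$$ For this $\ell$ too, $p^\star_i=\frac12-\frac{(\ell-2)k_i}{2S_\ell}$ for $1\le i\le\ell$ and $p^\star_i=0$ at all other nodes; and $\mathcal V^\star=\{1,\dots,\ell\}$ if and only if $k_\ell\ne T_\ell$. -/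

import Mathlib

open scoped Matrix

/-- A finite weighted graph on the node set `V`, given by its symmetric link weights;
`weight i j = 0` means that there is no link between `i` and `j`. -/
structure WeightedGraph (V : Type*) where
  weight : V → V → ℝ
  symm : ∀ i j, weight i j = weight j i
  nonneg : ∀ i j, 0 ≤ weight i j
  loopless : ∀ i, weight i i = 0

/-- `X` is the Moore–Penrose pseudoinverse of the real matrix `A` (the four Penrose equations). -/
structure IsMoorePenroseInverse {V : Type*} [Fintype V] (A X : Matrix V V ℝ) : Prop where
  mul_mul_self : A * X * A = A
  self_mul_mul : X * A * X = X
  symm_mul : (A * X)ᵀ = A * X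
  mul_symm : (X * A)ᵀ = X * A

theorem IsMoorePenroseInverse.unique {V : Type*} [Fintype V] {A X Y : Matrix V V ℝ}
    (hX : IsMoorePenroseInverse A X) (hY : IsMoorePenroseInverse A Y) : X = Y := by
  have h1 : A * X = A * Y := by
    calc A * X = (A * X)ᵀ := hX.symm_mul.symm
      _ = (A * Y * (A * X))ᵀ := by rw [← Matrix.mul_assoc, hY.mul_mul_self]
      _ = A * X * (A * Y) := by rw [Matrix.transpose_mul, hX.symm_mul, hY.symm_mul]
      _ = A * Y := by rw [← Matrix.mul_assoc, hX.mul_mul_self]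
  have h2 : X * A = Y * A := by
    calc X * A = X * A * (Y * A) := by
          rw [Matrix.mul_assoc X A, ← Matrix.mul_assoc A Y A, hY.mul_mul_self]
      _ = (Y * A * (X * A))ᵀ := by rw [Matrix.transpose_mul, hX.mul_symm, hY.mul_symm]
      _ = (Y * A)ᵀ := by rw [Matrix.mul_assoc Y A, ← Matrix.mul_assoc A X A, hX.mul_mul_self]
      _ = Y * A := hY.mul_symm
  calc X = X * A * X := hX.self_mul_mul.symm
    _ = Y * A * Y := by rw [h2, Matrix.mul_assoc, h1, ← Matrix.mul_assoc]
    _ = Y := hY.self_mul_mul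

theorem exists_isMoorePenroseInverse {V : Type*} [Fintype V] {A : Matrix V V ℝ}
    (hA : Aᵀ = A) : ∃ X, IsMoorePenroseInverse A X := by
  classical
  have hH : A.IsHermitian := by
    rw [Matrix.IsHermitian, Matrix.conjTranspose_eq_transpose_of_trivial, hA]
  set U : Matrix V V ℝ := hH.eigenvectorUnitary.1 with hU
  have hUU : Uᵀ * U = 1 := by
    have := Matrix.UnitaryGroup.star_mul_self hH.eigenvectorUnitary
    rwa [Matrix.star_eq_conjTranspose, Matrix.conjTranspose_eq_transpose_of_trivial] at this
  have hdiag : A = U * Matrix.diagonal hH.eigenvalues * Uᵀ := by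
    have := hH.spectral_theorem
    rw [Unitary.conjStarAlgAut_apply] at this
    rw [← Matrix.conjTranspose_eq_transpose_of_trivial U, ← Matrix.star_eq_conjTranspose]
    exact this
  set d := hH.eigenvalues
  have key : ∀ a b : V → ℝ, U * Matrix.diagonal a * Uᵀ * (U * Matrix.diagonal b * Uᵀ)
      = U * Matrix.diagonal (fun i => a i * b i) * Uᵀ := by
    intro a b
    calc _ = U * Matrix.diagonal a * (Uᵀ * U) * Matrix.diagonal b * Uᵀ := by
          simp only [Matrix.mul_assoc]
      _ = _ := by rw [hUU, Matrix.mul_one, Matrix.mul_assoc U, Matrix.diagonal_mul_diagonal]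
  have keyT : ∀ a : V → ℝ, (U * Matrix.diagonal a * Uᵀ)ᵀ = U * Matrix.diagonal a * Uᵀ := by
    intro a
    simp [Matrix.transpose_mul, Matrix.mul_assoc]
  refine ⟨U * Matrix.diagonal (fun i => (d i)⁻¹) * Uᵀ, ?_, ?_, ?_, ?_⟩
  · rw [hdiag, key, key]; simp [mul_inv_mul_cancel]
  · rw [hdiag, key, key]; congr; ext i; simpa using mul_inv_mul_cancel (d i)⁻¹
  · rw [hdiag, key, keyT]
  · rw [hdiag, key, keyT]

open Classical in
/-- The Moore–Penrose pseudoinverse. For symmetric matrices the default value is never used, by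
`exists_isMoorePenroseInverse`. -/
noncomputable def moorePenrose {V : Type*} [Fintype V] (A : Matrix V V ℝ) : Matrix V V ℝ :=
  if h : ∃ X, IsMoorePenroseInverse A X then h.choose else 0

namespace WeightedGraph

variable {V : Type*} [Fintype V]

/-- The weighted degree of a node. -/
def degree (G : WeightedGraph V) (i : V) : ℝ := ∑ j, G.weight i j

/-- The Laplacian matrix: degrees on the diagonal, minus the link weights off the diagonal. -/
def laplacian [DecidableEq V] (G : WeightedGraph V) : Matrix V V ℝ :=
  Matrix.of fun i j => if i = j then G.degree i else -G.weight i j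

/-- The effective resistance between the nodes `i` and `j` (of a connected graph). -/
noncomputable def resistance [DecidableEq V] (G : WeightedGraph V) (i j : V) : ℝ :=
  (Pi.single i 1 - Pi.single j 1) ⬝ᵥ
    (moorePenrose G.laplacian *ᵥ (Pi.single i 1 - Pi.single j 1))

/-- The matrix of effective resistances. -/
noncomputable def resistanceMatrix [DecidableEq V] (G : WeightedGraph V) : Matrix V V ℝ :=
  Matrix.of G.resistance

/-- The variance of a distribution with respect to the square root of the effective resistance. -/
noncomputable def variance [DecidableEq V] (G : WeightedGraph V) (p : V → ℝ) : ℝ :=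
  1 / 2 * (p ⬝ᵥ (G.resistanceMatrix *ᵥ p))

/-- `p` is a distribution of maximum variance among all distributions on the nodes of `G`. -/
def IsMaxVariance [DecidableEq V] (G : WeightedGraph V) (p : V → ℝ) : Prop :=
  p ∈ stdSimplex ℝ V ∧ ∀ q ∈ stdSimplex ℝ V, G.variance q ≤ G.variance p

end WeightedGraph

/-- The weighted star with centre `0` and leaves `1, …, n`; the leaf `i.succ` is linked to the
centre with weight `k i` and hence has degree `k i`. -/
def weightedStar {n : ℕ} (k : Fin n → ℝ) (hk : ∀ i, 0 < k i) : WeightedGraph (Fin (n + 1)) where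
  weight := Fin.cons (Fin.cons 0 k) (fun i => Fin.cons (k i) (fun _ => 0))
  symm i j := by
    cases i using Fin.cases <;> cases j using Fin.cases <;> simp
  nonneg i j := by
    cases i using Fin.cases <;> cases j using Fin.cases <;> simp [(hk _).le]
  loopless i := by
    cases i using Fin.cases <;> simp

/-- The support of a distribution. -/
def distSupport {V : Type*} (p : V → ℝ) : Set V := {i | 0 < p i}

/-- The first `ℓ` leaves `1, …, ℓ` of a star with centre `0` (those of smallest degree when the
degrees are increasing). -/
def firstLeaves (n ℓ : ℕ) : Set (Fin (n + 1)) := {x | 1 ≤ (x : ℕ) ∧ (x : ℕ) ≤ ℓ}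

/-- The sum `k₁ + ⋯ + k_ℓ`; the entry `k i` with `i : Fin n` is the degree of leaf number
`i + 1`. -/
def partialSum {n : ℕ} (k : Fin n → ℝ) (ℓ : ℕ) : ℝ := ∑ i ∈ Finset.univ.filter (fun i : Fin n => (i : ℕ) < ℓ), k i

/-- The quantity `(ℓ - 2)⁻¹ (k₁ + ⋯ + k_ℓ)`, read as `+∞` for `ℓ = 2`. -/
noncomputable def threshold {n : ℕ} (k : Fin n → ℝ) (ℓ : ℕ) : EReal :=
  if ℓ = 2 then ⊤ else ((((ℓ : ℝ) - 2)⁻¹ * partialSum k ℓ : ℝ) : EReal)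

/-- `1 ≤ ℓ ≤ n` and `k_ℓ < (ℓ - 2)⁻¹ (k₁ + ⋯ + k_ℓ) ≤ k_{ℓ+1}`, where the second inequality is
void for `ℓ = n`. -/
def IsSupportIndex {n : ℕ} (k : Fin n → ℝ) (ℓ : ℕ) : Prop :=
  1 ≤ ℓ ∧ ℓ ≤ n ∧
    (∀ i : Fin n, (i : ℕ) + 1 = ℓ → (k i : EReal) < threshold k ℓ) ∧
    (∀ i : Fin n, (i : ℕ) = ℓ → threshold k ℓ ≤ (k i : EReal))

/-- `1 ≤ ℓ ≤ n` and `k_ℓ ≤ (ℓ - 2)⁻¹ (k₁ + ⋯ + k_ℓ) < k_{ℓ+1}`, where the second inequality is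
void for `ℓ = n`. -/
def IsWeakSupportIndex {n : ℕ} (k : Fin n → ℝ) (ℓ : ℕ) : Prop :=
  1 ≤ ℓ ∧ ℓ ≤ n ∧
    (∀ i : Fin n, (i : ℕ) + 1 = ℓ → (k i : EReal) ≤ threshold k ℓ) ∧
    (∀ i : Fin n, (i : ℕ) = ℓ → threshold k ℓ < (k i : EReal))

/-- The vector with entry `1/2 - (ℓ - 2) k_i / (2 (k₁ + ⋯ + k_ℓ))` at the leaves `i = 1, …, ℓ` and
`0` at the centre and at all other leaves. -/
noncomputable def starDistribution {n : ℕ} (k : Fin n → ℝ) (ℓ : ℕ) : Fin (n + 1) → ℝ :=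
  Fin.cons 0 fun i =>
    if (i : ℕ) < ℓ then 1 / 2 - ((ℓ : ℝ) - 2) * k i / (2 * partialSum k ℓ) else 0

/-! In a star, resistances between distinct nodes add: `ω i j = r i + r j`, with `r = 1/k` at leaves
and `r = 0` at the centre. On probability vectors the variance is therefore the separable concave
quadratic `∑ r i * p i * (1 - p i)` (`weightedStar_variance`), so first-order (KKT) conditions
certify a global maximizer. The quadratic remainder `∑ r i * (q i - p i)^2` makes it unique
(`weightedStar_isMaxVariance_iff`).

For `starDistribution k ℓ` with multiplier `(ℓ - 2) / S_ℓ`, these conditions, including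
nonnegativity, reduce for monotone `k` and `ℓ ≥ 2` to `k_ℓ ≤ T_ℓ ≤ k_{ℓ+1}`, which both kinds of
index satisfy. Since `S_{ℓ+1} = S_ℓ + k_{ℓ+1}`, the bound on `k_{ℓ+1}` says exactly that the bound
on `k_ℓ` fails one step later, so the index is the last one satisfying a downward-closed condition.
-/

theorem isMoorePenroseInverse_moorePenrose {V : Type*} [Fintype V] {A : Matrix V V ℝ}
    (hA : Aᵀ = A) : IsMoorePenroseInverse A (moorePenrose A) := by
  have h := exists_isMoorePenroseInverse hA
  rw [moorePenrose, dif_pos h]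
  exact h.choose_spec

/-! ### Resistances from potentials -/

namespace WeightedGraph

variable {V : Type*} [Fintype V] [DecidableEq V]

theorem laplacian_transpose (G : WeightedGraph V) : G.laplacianᵀ = G.laplacian := by
  ext i j
  by_cases h : i = j
  · subst h; rfl
  · simp [laplacian, h, Ne.symm h, G.symm i j]

/-- If the potential `u` drives a unit current from `i` to `j`, the resistance between `i` and `j`
is the potential difference. -/
theorem resistance_eq_of_laplacian_mulVec (G : WeightedGraph V) {i j : V} {u : V → ℝ}
    (hu : G.laplacian *ᵥ u = Pi.single i 1 - Pi.single j 1) :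
    G.resistance i j = u i - u j := by
  have hX := (isMoorePenroseInverse_moorePenrose G.laplacian_transpose).mul_mul_self
  have h1 : G.laplacian *ᵥ (moorePenrose G.laplacian *ᵥ (G.laplacian *ᵥ u))
      = G.laplacian *ᵥ u := by
    rw [Matrix.mulVec_mulVec, Matrix.mulVec_mulVec, hX]
  rw [resistance, ← hu]
  -- Symmetry moves the left `Q` across: `(Q u)ᵀ X (Q u) = uᵀ (Q X Q u) = uᵀ Q u`.
  nth_rewrite 1 [← G.laplacian_transpose]
  rw [Matrix.mulVec_transpose, ← Matrix.dotProduct_mulVec, h1, hu, dotProduct_sub,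
    dotProduct_single_one, dotProduct_single_one]

end WeightedGraph

/-! ### Resistance and variance of the star -/

section Star

variable {n : ℕ} {k : Fin n → ℝ}

theorem weightedStar_degree_succ (hk : ∀ i, 0 < k i) (i : Fin n) :
    (weightedStar k hk).degree i.succ = k i := by
  simp [WeightedGraph.degree, weightedStar, Fin.sum_univ_succ]

/-- The resistances of the single links of the star, with the value `0` at the centre. -/
noncomputable def linkResistance (k : Fin n → ℝ) : Fin (n + 1) → ℝ :=
  Fin.cons 0 fun i => (k i)⁻¹

theorem linkResistance_nonneg (hk : ∀ i, 0 < k i) (i : Fin (n + 1)) :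
    0 ≤ linkResistance k i := by
  cases i using Fin.cases with
  | zero => simp [linkResistance]
  | succ i => simpa [linkResistance] using (hk i).le

/-- Potentials for currents into the centre; subtracting two of them gives the potential between any
two nodes. -/
theorem weightedStar_laplacian_mulVec_single (hk : ∀ i, 0 < k i) (i : Fin (n + 1)) :
    (weightedStar k hk).laplacian *ᵥ Pi.single i (linkResistance k i)
      = Pi.single i 1 - Pi.single 0 1 := by
  cases i using Fin.cases with
  | zero => simp [linkResistance]
  | succ i =>
    have hi := (hk i).ne'
    ext j
    rw [Matrix.mulVec_single]
    cases j using Fin.cases with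
    | zero =>
      simp [WeightedGraph.laplacian, linkResistance, weightedStar, hi, (Fin.succ_ne_zero i).symm]
    | succ j =>
      by_cases hj : j = i
      · subst hj
        simp [WeightedGraph.laplacian, linkResistance, weightedStar_degree_succ, hi]
      · simp [WeightedGraph.laplacian, linkResistance, weightedStar, hj]

theorem weightedStar_resistance (hk : ∀ i, 0 < k i) (i j : Fin (n + 1)) :
    (weightedStar k hk).resistance i j
      = if i = j then 0 else linkResistance k i + linkResistance k j := by
  rw [WeightedGraph.resistance_eq_of_laplacian_mulVec _ (u := Pi.single i (linkResistance k i) -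
    Pi.single j (linkResistance k j))]
  · by_cases h : i = j
    · subst h; simp
    · simp [h, Ne.symm h]
  · rw [Matrix.mulVec_sub, weightedStar_laplacian_mulVec_single,
      weightedStar_laplacian_mulVec_single, sub_sub_sub_cancel_right]

theorem weightedStar_variance (hk : ∀ i, 0 < k i) {p : Fin (n + 1) → ℝ} (hp : ∑ i, p i = 1) :
    (weightedStar k hk).variance p = ∑ i, linkResistance k i * (p i * (1 - p i)) := by
  set r := linkResistance k
  have h1 (i : Fin (n + 1)) : ∑ j, (if i = j then 0 else r i + r j) * p j
      = r i + ∑ j, r j * p j - 2 * r i * p i := by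
    have h2 (j : Fin (n + 1)) : (if i = j then 0 else r i + r j) * p j
        = r i * p j + r j * p j - if i = j then 2 * r j * p j else 0 := by
      by_cases h : i = j
      · subst h; simp; ring
      · simp [h]; ring
    simp_rw [h2]
    rw [Finset.sum_sub_distrib, Finset.sum_add_distrib, ← Finset.mul_sum, hp]
    simp
  simp only [WeightedGraph.variance, dotProduct, Matrix.mulVec, WeightedGraph.resistanceMatrix,
    Matrix.of_apply, weightedStar_resistance]
  have h3 : ∑ i, p i * ∑ j, (if i = j then 0 else r i + r j) * p j
      = 2 * ∑ i, r i * (p i * (1 - p i)) := by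
    simp_rw [h1]
    have h4 (i : Fin (n + 1)) : p i * (r i + ∑ j, r j * p j - 2 * r i * p i)
        = (2 * (r i * (p i * (1 - p i))) - r i * p i) + p i * ∑ j, r j * p j := by ring
    simp_rw [h4]
    rw [Finset.sum_add_distrib, ← Finset.sum_mul, hp, Finset.sum_sub_distrib, ← Finset.mul_sum]
    ring
  rw [h3]
  ring

/-- A distribution satisfying the first-order optimality conditions with multiplier `c` has larger
variance than any other distribution. -/
theorem weightedStar_variance_add_le (hk : ∀ i, 0 < k i) {p q : Fin (n + 1) → ℝ}
    (hp : ∑ i, p i = 1) (hq : q ∈ stdSimplex ℝ (Fin (n + 1))) (c : ℝ)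
    (h : ∀ i, linkResistance k i * (1 - 2 * p i) ≤ c)
    (h' : ∀ i, p i ≠ 0 → linkResistance k i * (1 - 2 * p i) = c) :
    (weightedStar k hk).variance q + ∑ i, linkResistance k i * (q i - p i) ^ 2
      ≤ (weightedStar k hk).variance p := by
  rw [weightedStar_variance hk hp, weightedStar_variance hk hq.2, ← Finset.sum_add_distrib]
  -- The left side equals `r p (1 - p) + r (1 - 2 p) (q - p)`, the exact Taylor expansion at `p`.
  have h1 (i : Fin (n + 1)) : linkResistance k i * (q i * (1 - q i)) +
      linkResistance k i * (q i - p i) ^ 2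
        ≤ linkResistance k i * (p i * (1 - p i)) + (c * q i - c * p i) := by
    have h2 : linkResistance k i * (1 - 2 * p i) * (q i - p i) ≤ c * (q i - p i) := by
      by_cases h0 : p i = 0
      · have := mul_le_mul_of_nonneg_right (h i) (hq.1 i)
        simpa [h0] using this
      · rw [h' i h0]
    linarith
  refine (Finset.sum_le_sum fun i _ => h1 i).trans_eq ?_
  rw [Finset.sum_add_distrib, Finset.sum_sub_distrib, ← Finset.mul_sum, ← Finset.mul_sum, hp, hq.2]
  ring

theorem weightedStar_isMaxVariance_iff (hk : ∀ i, 0 < k i) {p : Fin (n + 1) → ℝ}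
    (hp : p ∈ stdSimplex ℝ (Fin (n + 1))) (c : ℝ)
    (h : ∀ i, linkResistance k i * (1 - 2 * p i) ≤ c)
    (h' : ∀ i, p i ≠ 0 → linkResistance k i * (1 - 2 * p i) = c) (q : Fin (n + 1) → ℝ) :
    (weightedStar k hk).IsMaxVariance q ↔ q = p := by
  have key {q : Fin (n + 1) → ℝ} (hq : q ∈ stdSimplex ℝ (Fin (n + 1))) :=
    weightedStar_variance_add_le hk hp.2 hq c h h'
  have hpos (q : Fin (n + 1) → ℝ) (i : Fin (n + 1)) :
      0 ≤ linkResistance k i * (q i - p i) ^ 2 :=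
    mul_nonneg (linkResistance_nonneg hk i) (sq_nonneg _)
  constructor
  · intro hq
    have h0 : ∑ i, linkResistance k i * (q i - p i) ^ 2 = 0 :=
      le_antisymm (by linarith [key hq.1, hq.2 p hp]) (Finset.sum_nonneg fun i _ => hpos q i)
    rw [Finset.sum_eq_zero_iff_of_nonneg fun i _ => hpos q i] at h0
    have hleaf (i : Fin n) : q i.succ = p i.succ := by
      have := h0 i.succ (Finset.mem_univ _)
      simpa [linkResistance, (hk i).ne', sub_eq_zero] using this
    -- The remainder does not see the centre, where `r = 0`; total mass fixes that entry.
    have hsum := hq.1.2.trans hp.2.symm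
    rw [Fin.sum_univ_succ, Fin.sum_univ_succ] at hsum
    simp only [hleaf] at hsum
    ext i
    cases i using Fin.cases with
    | zero => linarith
    | succ i => exact hleaf i
  · rintro rfl
    exact ⟨hp, fun q' hq' => by
      linarith [key hq', Finset.sum_nonneg fun i (_ : i ∈ Finset.univ) => hpos q' i]⟩

/-! ### Existence and uniqueness of the index -/

theorem partialSum_succ (k : Fin n → ℝ) (i : Fin n) :
    partialSum k (i + 1) = partialSum k i + k i := by
  have : Finset.univ.filter (fun j : Fin n => (j : ℕ) < i + 1)
      = insert i (Finset.univ.filter (fun j : Fin n => (j : ℕ) < i)) := by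
    ext j
    simp [Fin.ext_iff, le_iff_eq_or_lt, Order.lt_add_one_iff]
  rw [partialSum, this, Finset.sum_insert (by simp), add_comm, partialSum]

theorem partialSum_pos (hk : ∀ i, 0 < k i) {ℓ : ℕ} (h1 : 1 ≤ ℓ) (hn : 0 < n) :
    0 < partialSum k ℓ :=
  Finset.sum_pos (fun i _ => hk i) ⟨⟨0, hn⟩, by simp; omega⟩

theorem coe_lt_threshold_iff (hk : ∀ i, 0 < k i) {ℓ : ℕ} (hℓ : 2 ≤ ℓ) (hn : 0 < n) (x : ℝ) :
    (x : EReal) < threshold k ℓ ↔ ((ℓ : ℝ) - 2) * x < partialSum k ℓ := by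
  rcases hℓ.eq_or_lt with rfl | h
  · simpa [threshold] using partialSum_pos hk (by norm_num) hn
  · have h' : (0 : ℝ) < (ℓ : ℝ) - 2 := sub_pos.2 (by exact_mod_cast h)
    rw [threshold, if_neg h.ne', EReal.coe_lt_coe_iff, lt_inv_mul_iff₀ h']

theorem coe_le_threshold_iff (hk : ∀ i, 0 < k i) {ℓ : ℕ} (hℓ : 2 ≤ ℓ) (hn : 0 < n) (x : ℝ) :
    (x : EReal) ≤ threshold k ℓ ↔ ((ℓ : ℝ) - 2) * x ≤ partialSum k ℓ := by
  rcases hℓ.eq_or_lt with rfl | h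
  · simpa [threshold] using (partialSum_pos hk (by norm_num) hn).le
  · have h' : (0 : ℝ) < (ℓ : ℝ) - 2 := sub_pos.2 (by exact_mod_cast h)
    rw [threshold, if_neg h.ne', EReal.coe_le_coe_iff, le_inv_mul_iff₀ h']

/-- Here `T_1 = -k_1` is negative; this forces `ℓ ≥ 2` for both kinds of index. -/
theorem not_coe_le_threshold_one (hk : ∀ i, 0 < k i) (hn : 0 < n) (i : Fin n) :
    ¬ (k i : EReal) ≤ threshold k 1 := by
  rw [threshold, if_neg (by norm_num), EReal.coe_le_coe_iff]
  have := partialSum_pos hk le_rfl hn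
  have := hk i
  norm_num
  linarith

theorem IsSupportIndex.two_le (hk : ∀ i, 0 < k i) {ℓ : ℕ} (h : IsSupportIndex k ℓ) : 2 ≤ ℓ := by
  obtain ⟨h1, h2, h3, -⟩ := h
  rcases h1.eq_or_lt with rfl | h1
  · exact absurd (h3 ⟨0, h2⟩ rfl).le (not_coe_le_threshold_one hk h2 _)
  · exact h1

theorem IsWeakSupportIndex.two_le (hk : ∀ i, 0 < k i) {ℓ : ℕ} (h : IsWeakSupportIndex k ℓ) :
    2 ≤ ℓ := by
  obtain ⟨h1, h2, h3, -⟩ := h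
  rcases h1.eq_or_lt with rfl | h1
  · exact absurd (h3 ⟨0, h2⟩ rfl) (not_coe_le_threshold_one hk h2 _)
  · exact h1

theorem existsUnique_last {P : ℕ → Prop} {m n : ℕ} (hmn : m ≤ n) (hm : P m)
    (hP : ∀ ℓ, m ≤ ℓ → ℓ < n → P (ℓ + 1) → P ℓ) :
    ∃! ℓ, m ≤ ℓ ∧ ℓ ≤ n ∧ P ℓ ∧ (ℓ < n → ¬ P (ℓ + 1)) := by
  classical
  have hanti {a b : ℕ} (ha : m ≤ a) (hab : a ≤ b) (hb : b ≤ n) (hPb : P b) : P a := by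
    induction b, hab using Nat.le_induction with
    | base => exact hPb
    | succ b hab ih => exact ih (by omega) (hP b (ha.trans hab) hb hPb)
  refine ⟨Nat.findGreatest P n, ⟨Nat.le_findGreatest hmn hm, Nat.findGreatest_le n,
    Nat.findGreatest_spec hmn hm, fun h => Nat.findGreatest_is_greatest (Nat.lt_succ_self _) h⟩, ?_⟩
  rintro ℓ ⟨h1, h2, h3, h4⟩
  refine le_antisymm (Nat.le_findGreatest h2 h3) (not_lt.1 fun h => ?_)
  have hle := Nat.findGreatest_le (P := P) n
  exact h4 (h.trans_le hle)
    (hanti (Nat.le_succ_of_le h1) h hle (Nat.findGreatest_spec hmn hm))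

theorem existsUnique_isSupportIndex (hn : 2 ≤ n) (hk : ∀ i, 0 < k i) (hmono : Monotone k) :
    ∃! ℓ : ℕ, IsSupportIndex k ℓ := by
  have hn0 : 0 < n := by omega
  have key := existsUnique_last (n := n)
    (P := fun ℓ => ∀ i : Fin n, (i : ℕ) + 1 = ℓ → ((ℓ : ℝ) - 2) * k i < partialSum k ℓ) hn
    (fun i _ => by simpa using partialSum_pos hk (by norm_num) hn0)
    (fun ℓ h2 hℓ h i hi => by
      -- The entry `⟨ℓ, hℓ⟩` is `k_{ℓ+1}`. Cancelling it from `(ℓ - 1) k_{ℓ+1} < S_{ℓ+1}` leaves `(ℓ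
      -- - 2) k_{ℓ+1} < S_ℓ`, and `k_ℓ ≤ k_{ℓ+1}`.
      have h3 := h ⟨ℓ, hℓ⟩ rfl
      have h4 := partialSum_succ k ⟨ℓ, hℓ⟩
      have h5 : k i ≤ k ⟨ℓ, hℓ⟩ := hmono (Fin.le_def.2 (by simp; omega))
      have h6 : (0 : ℝ) ≤ (ℓ : ℝ) - 2 := sub_nonneg.2 (by exact_mod_cast h2)
      have h7 := mul_le_mul_of_nonneg_left h5 h6
      push_cast at h3 h4
      linarith)
  refine (existsUnique_congr fun ℓ => ?_).1 key
  constructor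
  · rintro ⟨h1, h2, h3, h4⟩
    refine ⟨by omega, h2, fun i hi => (coe_lt_threshold_iff hk h1 hn0 _).2 (h3 i hi), ?_⟩
    rintro i rfl
    rw [← not_lt, coe_lt_threshold_iff hk h1 hn0]
    intro h
    refine h4 i.2 fun j hj => ?_
    obtain rfl : j = i := Fin.ext (by omega)
    have := partialSum_succ k j
    push_cast
    linarith
  · intro h
    have h1 := h.two_le hk
    refine ⟨h1, h.2.1, fun i hi => (coe_lt_threshold_iff hk h1 hn0 _).1 (h.2.2.1 i hi), ?_⟩
    intro hℓ h5
    have h6 := h.2.2.2 ⟨ℓ, hℓ⟩ rfl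
    rw [← not_lt, coe_lt_threshold_iff hk h1 hn0] at h6
    have h7 := h5 ⟨ℓ, hℓ⟩ rfl
    have := partialSum_succ k ⟨ℓ, hℓ⟩
    push_cast at h7 this
    exact h6 (by linarith)

theorem existsUnique_isWeakSupportIndex (hn : 2 ≤ n) (hk : ∀ i, 0 < k i) (hmono : Monotone k) :
    ∃! ℓ : ℕ, IsWeakSupportIndex k ℓ := by
  have hn0 : 0 < n := by omega
  have key := existsUnique_last (n := n)
    (P := fun ℓ => ∀ i : Fin n, (i : ℕ) + 1 = ℓ → ((ℓ : ℝ) - 2) * k i ≤ partialSum k ℓ) hn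
    (fun i _ => by simpa using (partialSum_pos hk (by norm_num) hn0).le)
    (fun ℓ h2 hℓ h i hi => by
      have h3 := h ⟨ℓ, hℓ⟩ rfl
      have h4 := partialSum_succ k ⟨ℓ, hℓ⟩
      have h5 : k i ≤ k ⟨ℓ, hℓ⟩ := hmono (Fin.le_def.2 (by simp; omega))
      have h6 : (0 : ℝ) ≤ (ℓ : ℝ) - 2 := sub_nonneg.2 (by exact_mod_cast h2)
      have h7 := mul_le_mul_of_nonneg_left h5 h6
      push_cast at h3 h4
      linarith)
  refine (existsUnique_congr fun ℓ => ?_).1 key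
  constructor
  · rintro ⟨h1, h2, h3, h4⟩
    refine ⟨by omega, h2, fun i hi => (coe_le_threshold_iff hk h1 hn0 _).2 (h3 i hi), ?_⟩
    rintro i rfl
    rw [← not_le, coe_le_threshold_iff hk h1 hn0]
    intro h
    refine h4 i.2 fun j hj => ?_
    obtain rfl : j = i := Fin.ext (by omega)
    have := partialSum_succ k j
    push_cast
    linarith
  · intro h
    have h1 := h.two_le hk
    refine ⟨h1, h.2.1, fun i hi => (coe_le_threshold_iff hk h1 hn0 _).1 (h.2.2.1 i hi), ?_⟩
    intro hℓ h5
    have h6 := h.2.2.2 ⟨ℓ, hℓ⟩ rfl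
    rw [← not_le, coe_le_threshold_iff hk h1 hn0] at h6
    have h7 := h5 ⟨ℓ, hℓ⟩ rfl
    have := partialSum_succ k ⟨ℓ, hℓ⟩
    push_cast at h7 this
    exact h6 (by linarith)

/-! ### Optimality and support of the candidate -/

theorem sum_starDistribution (hk : ∀ i, 0 < k i) {ℓ : ℕ} (h1 : 1 ≤ ℓ) (hℓ : ℓ ≤ n) :
    ∑ i, starDistribution k ℓ i = 1 := by
  have hS := partialSum_pos hk h1 (h1.trans hℓ)
  have hcard : (Finset.univ.filter fun i : Fin n => (i : ℕ) < ℓ).card = ℓ := by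
    rw [Fin.card_filter_val_lt, min_eq_right hℓ]
  simp only [Fin.sum_univ_succ, starDistribution, Fin.cons_zero, Fin.cons_succ]
  rw [← Finset.sum_filter, Finset.sum_sub_distrib, Finset.sum_const, hcard, ← Finset.sum_div,
    ← Finset.mul_sum, ← partialSum]
  simp only [nsmul_eq_mul]
  field_simp
  ring

theorem starDistribution_succ_nonneg_iff (hk : ∀ i, 0 < k i) {ℓ : ℕ} (h1 : 1 ≤ ℓ) {i : Fin n}
    (hi : (i : ℕ) < ℓ) :
    0 ≤ starDistribution k ℓ i.succ ↔ ((ℓ : ℝ) - 2) * k i ≤ partialSum k ℓ := by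
  have hS := partialSum_pos hk h1 i.pos
  simp only [starDistribution, Fin.cons_succ, if_pos hi]
  rw [sub_nonneg, div_le_div_iff₀ (by positivity) two_pos]
  constructor <;> intro h <;> linarith

theorem starDistribution_succ_pos_iff (hk : ∀ i, 0 < k i) {ℓ : ℕ} (h1 : 1 ≤ ℓ) {i : Fin n}
    (hi : (i : ℕ) < ℓ) :
    0 < starDistribution k ℓ i.succ ↔ ((ℓ : ℝ) - 2) * k i < partialSum k ℓ := by
  have hS := partialSum_pos hk h1 i.pos
  simp only [starDistribution, Fin.cons_succ, if_pos hi]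
  rw [sub_pos, div_lt_div_iff₀ (by positivity) two_pos]
  constructor <;> intro h <;> linarith

/-- The bound on `k_ℓ` gives nonnegativity, the bound on `k_{ℓ+1}` gives `1 / k_i ≤ c` at unused
leaves, and `ℓ ≥ 2` gives `0 ≤ c` at the centre. -/
theorem weightedStar_isMaxVariance_iff_eq_starDistribution (hk : ∀ i, 0 < k i)
    (hmono : Monotone k) {ℓ : ℕ} (h2 : 2 ≤ ℓ) (hℓ : ℓ ≤ n)
    (hle : ∀ i : Fin n, (i : ℕ) + 1 = ℓ → (k i : EReal) ≤ threshold k ℓ)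
    (hge : ∀ i : Fin n, (i : ℕ) = ℓ → threshold k ℓ ≤ (k i : EReal)) (q : Fin (n + 1) → ℝ) :
    (weightedStar k hk).IsMaxVariance q ↔ q = starDistribution k ℓ := by
  have hn0 : 0 < n := by omega
  have hS := partialSum_pos hk (one_le_two.trans h2) hn0
  have hc : (0 : ℝ) ≤ (ℓ : ℝ) - 2 := sub_nonneg.2 (by exact_mod_cast h2)
  have hlow (i : Fin n) (hi : (i : ℕ) < ℓ) : ((ℓ : ℝ) - 2) * k i ≤ partialSum k ℓ := by
    rw [← coe_le_threshold_iff hk h2 hn0]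
    refine le_trans (EReal.coe_le_coe_iff.2 (hmono ?_)) (hle ⟨ℓ - 1, by omega⟩ (by simp; omega))
    exact Fin.le_def.2 (by simp; omega)
  have hhigh (i : Fin n) (hi : ℓ ≤ (i : ℕ)) : partialSum k ℓ ≤ ((ℓ : ℝ) - 2) * k i := by
    rw [← not_lt, ← coe_lt_threshold_iff hk h2 hn0, not_lt]
    exact (hge ⟨ℓ, hi.trans_lt i.2⟩ rfl).trans (EReal.coe_le_coe_iff.2 (hmono (Fin.le_def.2 hi)))
  have hgrad (i : Fin n) (hi : (i : ℕ) < ℓ) :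
      linkResistance k i.succ * (1 - 2 * starDistribution k ℓ i.succ)
        = ((ℓ : ℝ) - 2) / partialSum k ℓ := by
    have := (hk i).ne'
    simp only [linkResistance, starDistribution, Fin.cons_succ, if_pos hi]
    field_simp
    ring
  refine weightedStar_isMaxVariance_iff hk
    ⟨fun i => ?_, sum_starDistribution hk (one_le_two.trans h2) hℓ⟩
    (((ℓ : ℝ) - 2) / partialSum k ℓ) (fun i => ?_) (fun i hi => ?_) q
  · cases i using Fin.cases with
    | zero => simp [starDistribution]
    | succ i =>
      by_cases hi : (i : ℕ) < ℓ
      · exact (starDistribution_succ_nonneg_iff hk (one_le_two.trans h2) hi).2 (hlow i hi)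
      · simp [starDistribution, hi]
  · cases i using Fin.cases with
    | zero => simpa [linkResistance] using div_nonneg hc hS.le
    | succ i =>
      by_cases hi : (i : ℕ) < ℓ
      · exact (hgrad i hi).le
      · have h3 := hhigh i (not_lt.1 hi)
        simp only [linkResistance, starDistribution, Fin.cons_succ, if_neg hi]
        rw [mul_zero, sub_zero, mul_one, inv_eq_one_div, div_le_div_iff₀ (hk i) hS]
        linarith
  · cases i using Fin.cases with
    | zero => simp [starDistribution] at hi
    | succ i =>
      by_cases h : (i : ℕ) < ℓ
      · exact hgrad i h
      · simp [starDistribution, h] at hi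

/-- As `k` increases and `ℓ ≥ 2`, the entry at leaf `ℓ` is the smallest of the first `ℓ`, so only
its positivity matters. -/
theorem distSupport_starDistribution_eq_iff (hk : ∀ i, 0 < k i) (hmono : Monotone k) {ℓ : ℕ}
    (h2 : 2 ≤ ℓ) (hℓ : ℓ ≤ n) :
    distSupport (starDistribution k ℓ) = firstLeaves n ℓ ↔
      ∀ i : Fin n, (i : ℕ) + 1 = ℓ → (k i : EReal) < threshold k ℓ := by
  have hn0 : 0 < n := by omega
  have h1 := one_le_two.trans h2
  constructor
  · intro h i hi
    have hmem : i.succ ∈ firstLeaves n ℓ := by simpa [firstLeaves, hi] using h1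
    rw [← h] at hmem
    rw [coe_lt_threshold_iff hk h2 hn0, ← starDistribution_succ_pos_iff hk h1 (by omega)]
    exact hmem
  · intro h
    ext i
    cases i using Fin.cases with
    | zero => simp [distSupport, firstLeaves, starDistribution]
    | succ i =>
      by_cases hi : (i : ℕ) < ℓ
      · have hpos : 0 < starDistribution k ℓ i.succ := by
          rw [starDistribution_succ_pos_iff hk h1 hi, ← coe_lt_threshold_iff hk h2 hn0]
          refine lt_of_le_of_lt (EReal.coe_le_coe_iff.2 (hmono ?_))
            (h ⟨ℓ - 1, by omega⟩ (by simp; omega))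
          exact Fin.le_def.2 (by simp; omega)
        exact iff_of_true hpos (by simpa [firstLeaves] using hi)
      · exact iff_of_false (by simp [distSupport, starDistribution, hi])
          (by simpa [firstLeaves] using hi)

end Star

theorem mainTheorem4 (n : ℕ) (hn : 2 ≤ n) (k : Fin n → ℝ) (hk : ∀ i, 0 < k i)
    (hmono : Monotone k) :
    (∃! p : Fin (n + 1) → ℝ, (weightedStar k hk).IsMaxVariance p) ∧
    (∃! ℓ : ℕ, IsSupportIndex k ℓ) ∧
    (∃! ℓ : ℕ, IsWeakSupportIndex k ℓ) ∧
    ∀ p : Fin (n + 1) → ℝ, (weightedStar k hk).IsMaxVariance p →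
      (∀ ℓ : ℕ, IsSupportIndex k ℓ →
        distSupport p = firstLeaves n ℓ ∧ p = starDistribution k ℓ) ∧
      (∀ ℓ : ℕ, IsWeakSupportIndex k ℓ →
        p = starDistribution k ℓ ∧
        (distSupport p = firstLeaves n ℓ ↔
          ∀ i : Fin n, (i : ℕ) + 1 = ℓ → (k i : EReal) ≠ threshold k ℓ)) := by
  have hstrict {ℓ : ℕ} (h : IsSupportIndex k ℓ) (p : Fin (n + 1) → ℝ) :
      (weightedStar k hk).IsMaxVariance p ↔ p = starDistribution k ℓ :=
    weightedStar_isMaxVariance_iff_eq_starDistribution hk hmono (h.two_le hk) h.2.1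
      (fun i hi => (h.2.2.1 i hi).le) h.2.2.2 p
  have hweak {ℓ : ℕ} (h : IsWeakSupportIndex k ℓ) (p : Fin (n + 1) → ℝ) :
      (weightedStar k hk).IsMaxVariance p ↔ p = starDistribution k ℓ :=
    weightedStar_isMaxVariance_iff_eq_starDistribution hk hmono (h.two_le hk) h.2.1
      h.2.2.1 (fun i hi => (h.2.2.2 i hi).le) p
  have hex := existsUnique_isSupportIndex hn hk hmono
  obtain ⟨ℓ₀, hℓ₀⟩ := hex.exists
  refine ⟨⟨starDistribution k ℓ₀, (hstrict hℓ₀ _).2 rfl, fun q hq => (hstrict hℓ₀ q).1 hq⟩, hex,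
    existsUnique_isWeakSupportIndex hn hk hmono, fun p hp => ⟨fun ℓ h => ?_, fun ℓ h => ?_⟩⟩
  · obtain rfl := (hstrict h p).1 hp
    exact ⟨(distSupport_starDistribution_eq_iff hk hmono (h.two_le hk) h.2.1).2 h.2.2.1, rfl⟩
  · obtain rfl := (hweak h p).1 hp
    refine ⟨rfl, (distSupport_starDistribution_eq_iff hk hmono (h.two_le hk) h.2.1).trans ?_⟩
    exact ⟨fun h' i hi => (h' i hi).ne, fun h' i hi => (h.2.2.1 i hi).lt_of_ne (h' i hi)⟩
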